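/- Let $G$ be a finitely generated group that is recursively presented, i.e. $G\cong\langle S\mid R\rangle$ for some recursive set $S$ and some recursively enumerable set $R$ of elements of the free group $\mathbb F_S$, and let $H\le G$ be a finitely generated subgroup. Suppose that $H$ is realizable: there are a non-empty finite alphabet $A$ and a non-empty $G$-subshift of finite type $X\subseteq A^G$ (the set of all $x\in A^G$ in which no pattern of some finite set of finitely supported patterns appears) such that $\{\mathrm{stab}(x)\mid x\in X\}=\{H\}$, where $\mathrm{stab}(x)=\{g\in G\mid g\cdot x=x\}$ for the shift action $(g\cdot x)(h)=x(g^{-1}h)$. Then the subgroup membership problem of $H$ in $G$ is decidable: for every finite symmetric generating set $T$ of $G$ there is an algorithm which, given words $u,w_1,\dots,w_k\in T^*$ such that $H=\langle\overline w_1,\dots,\overline w_k\rangle$, decides whether $\overline u\in H$; here $\overline w\in G$ denotes the element represented by the word $w$. -/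

import Mathlib

namespace SubgroupRealizability

open SymbolicDynamics.FullShift

/-! ### Shifts of finite type and stabilizers -/

/-- A set `X ⊆ A^G` of configurations is a `G`-subshift of finite type if it is the set of
configurations in which no pattern of some finite set of (finitely supported) patterns appears.
A pattern `p` appears in `x` if for some `g` we have `x (g * h) = p h` on the support of `p`. -/
def IsSFT {A G : Type*} [Inhabited A] [Group G] (X : Set (G → A)) : Prop :=
  ∃ F : Set (Pattern A G), F.Finite ∧ X = mulForbidden F

/-- The stabilizer `{g | g • x = x}` of a configuration `x : G → A` under the shift action
`(g • x) h = x (g⁻¹ * h)` of `G` on `A^G`. -/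
def stab {A G : Type*} [Group G] (x : G → A) : Subgroup G :=
  letI : MulAction G (G → A) := arrowAction
  MulAction.stabilizer G x

theorem mem_stab_iff {A G : Type*} [Group G] {x : G → A} {g : G} :
    g ∈ stab x ↔ ∀ h : G, x (g⁻¹ * h) = x h :=
  funext_iff

/-- A family of subgroups of `G` is realizable if it is the set of stabilizers of the
configurations of some non-empty `G`-SFT over some non-empty finite alphabet. -/
def IsRealizableFamily {G : Type*} [Group G] (𝒢 : Set (Subgroup G)) : Prop :=
  ∃ (A : Type) (_ : Finite A) (_ : Inhabited A) (X : Set (G → A)),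
    IsSFT X ∧ X.Nonempty ∧ stab '' X = 𝒢

/-- A subgroup `H` is realizable if the family `{H}` is. -/
def IsRealizable {G : Type*} [Group G] (H : Subgroup G) : Prop :=
  IsRealizableFamily {H}

/-! ### Recursively presented groups -/

/-- `G` is recursively presented if it has a presentation `⟨S | R⟩` where `S` is a recursive set
(of symbols, coded by natural numbers; finite or infinite) and `R ⊆ F_S` is recursively enumerable,
that is, the set of words over `S ∪ S⁻¹` which represent an element of `R` is recursively
enumerable. The letters `(n, true)` and `(n, false)` stand for `n` and `n⁻¹`. -/
def IsRecursivelyPresented (G : Type*) [Group G] : Prop :=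
  ∃ (S : Set ℕ) (R : Set (FreeGroup S)),
    ComputablePred (fun n : ℕ => n ∈ S) ∧
    REPred (fun w : List (ℕ × Bool) => ∃ v : List (S × Bool),
      v.map (fun a => ((a.1 : ℕ), a.2)) = w ∧ FreeGroup.mk v ∈ R) ∧
    Nonempty (G ≃* PresentedGroup R)

/-! ### The subgroup membership problem -/

/-- A tuple `s` that enumerates a finite symmetric generating set of `G`. -/
def IsSymmGenerating {G : Type*} [Group G] {n : ℕ} (s : Fin n → G) : Prop :=
  (Set.range s)⁻¹ = Set.range s ∧ Subgroup.closure (Set.range s) = ⊤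

/-- The element of `G` represented by a word over the generators `s`. -/
def wordEval {G : Type*} [Group G] {n : ℕ} (s : Fin n → G) (w : List (Fin n)) : G :=
  (w.map s).prod

/-- The subgroup membership problem of `H` in `G` with respect to the generators `s` is decidable:
some algorithm, given words `u` and `w₁, …, w_k` over the generators such that the elements
represented by the `w_i` generate `H`, decides whether the element represented by `u` lies
in `H`. -/
def MembershipDecidable {G : Type*} [Group G] {n : ℕ} (s : Fin n → G) (H : Subgroup G) : Prop :=
  ∃ f : List (Fin n) × List (List (Fin n)) → Bool, Computable f ∧
    ∀ (u : List (Fin n)) (ws : List (List (Fin n))),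
      Subgroup.closure {g : G | ∃ w ∈ ws, wordEval s w = g} = H →
        (f (u, ws) = true ↔ wordEval s u ∈ H)

end SubgroupRealizability

/-! ### Closure properties of recursively enumerable predicates. -/

section RecursivelyEnumerable

open Encodable

variable {α β : Type*} [Primcodable α] [Primcodable β]

/-! By Post's theorem it suffices to semidecide both membership in `H` and its negation. Equality of
words in a recursively presented group is semidecidable, by enumerating products of conjugates of
relators; since `H` is finitely generated, membership follows by searching for a product of
generators (`re_wordEval_mem`).

For non-membership, every configuration of the non-empty SFT `X` has stabilizer `H`, so an element
lies outside `H` exactly when it fixes no point of `X`. Pull configurations on `G` back to sequences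
indexed by codes of words. Such a sequence fails to come from a fixed point of `X` exactly when it
contains one of a recursively enumerable family of finite obstructions. By compactness, if every
sequence contains one, then every word of some finite length does too, and this can be found by
search (`REPred.forall_exists_extends`, `re_forall_wordEval_notMem_stab`). -/

theorem REPred.exists_of_primrecRel_nat {q : α → ℕ → Prop} (hq : PrimrecRel q) :
    REPred fun a => ∃ k, q a k := by
  classical
  have h : Partrec fun a => Nat.rfind fun k => Part.some (decide (q a k)) :=
    Partrec.rfind (p := fun a k => Part.some (decide (q a k))) hq.decide.to_comp.partrec
  exact h.dom_re.of_eq fun a => Nat.rfind_dom.trans (by simp)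

theorem REPred.exists_of_primrecRel {q : α → β → Prop} (hq : PrimrecRel q) :
    REPred fun a => ∃ b, q a b := by
  classical
  have h : PrimrecRel fun (a : α) (n : ℕ) =>
      (Option.casesOn (motive := fun _ => Bool) (decode (α := β) n) false
        fun b => decide (q a b)) = true := by
    refine Primrec.primrecPred ?_
    simp only [Bool.decide_eq_true]
    exact Primrec.option_casesOn (Primrec.decode.comp Primrec.snd) (Primrec.const false)
      (hq.decide.comp (Primrec.fst.comp Primrec.fst) Primrec.snd)
  refine (REPred.exists_of_primrecRel_nat h).of_eq fun a => ?_
  constructor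
  · rintro ⟨n, hn⟩
    cases hd : decode (α := β) n with
    | none => simp [hd] at hn
    | some b => exact ⟨b, by simpa [hd] using hn⟩
  · rintro ⟨b, hb⟩
    exact ⟨encode b, by simpa using hb⟩

/-- A recursively enumerable predicate is the increasing union of uniformly primitive recursive
predicates. -/
theorem REPred.exists_primrecRel {p : α → Prop} (hp : REPred p) :
    ∃ q : α → ℕ → Prop, PrimrecRel q ∧ (∀ a, p a ↔ ∃ k, q a k) ∧
      ∀ a k l, k ≤ l → q a k → q a l := by
  obtain ⟨c, hc⟩ := Nat.Partrec.Code.exists_code.1 hp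
  -- The stage `k` bounds the evaluation of a code that semidecides `p`.
  refine ⟨fun a k => (Nat.Partrec.Code.evaln k c (encode a)).isSome = true, ?_, ?_, ?_⟩
  · refine Primrec.primrecPred ?_
    simp only [Bool.decide_eq_true]
    exact Primrec.option_isSome.comp (Nat.Partrec.Code.primrec_evaln.comp
      ((Primrec.snd.pair (Primrec.const c)).pair (Primrec.encode.comp Primrec.fst)))
  · intro a
    have h1 : p a ↔ (Nat.Partrec.Code.eval c (encode a)).Dom := by
      rw [hc]
      simp [Part.bind, Part.assert]
    rw [h1, Part.dom_iff_mem]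
    simp only [Nat.Partrec.Code.evaln_complete, Option.isSome_iff_exists]
    exact exists_comm
  · intro a k l hkl h
    obtain ⟨x, hx⟩ := Option.isSome_iff_exists.1 h
    exact Option.isSome_iff_exists.2 ⟨x, Nat.Partrec.Code.evaln_mono hkl hx⟩

theorem PrimrecPred.to_re {p : α → Prop} (hp : PrimrecPred p) : REPred p := by
  classical
  exact ComputablePred.to_re ⟨inferInstance, hp.decide.to_comp⟩

theorem PrimrecPred.mem_list [DecidableEq α] (l : List α) : PrimrecPred fun a => a ∈ l := by
  have h : PrimrecRel fun a b : α => a = b := Primrec.eq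
  exact (h.exists_mem_list.comp (Primrec.const l) Primrec.id).of_eq fun a => by simp

theorem REPred.comp {p : β → Prop} (hp : REPred p) {f : α → β} (hf : Computable f) :
    REPred fun a => p (f a) :=
  Partrec.comp (f := fun b => Part.assert (p b) fun _ => Part.some ()) hp hf

/-- Dovetailing: search over pairs of a witness and a stage. -/
protected theorem REPred.exists {p : α → β → Prop} (hp : REPred fun x : α × β => p x.1 x.2) :
    REPred fun a => ∃ b, p a b := by
  obtain ⟨q, hq, hpq, -⟩ := hp.exists_primrecRel
  have h : PrimrecRel fun (a : α) (x : β × ℕ) => q (a, x.1) x.2 :=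
    hq.comp (Primrec.fst.pair (Primrec.fst.comp Primrec.snd)) (Primrec.snd.comp Primrec.snd)
  refine (REPred.exists_of_primrecRel h).of_eq fun a => ?_
  simp only [Prod.exists]
  exact exists_congr fun b => (hpq (a, b)).symm

protected theorem REPred.and {p q : α → Prop} (hp : REPred p) (hq : REPred q) :
    REPred fun a => p a ∧ q a := by
  obtain ⟨p', hp', h1, -⟩ := hp.exists_primrecRel
  obtain ⟨q', hq', h2, -⟩ := hq.exists_primrecRel
  have h : PrimrecRel fun (a : α) (x : ℕ × ℕ) => p' a x.1 ∧ q' a x.2 :=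
    (hp'.comp Primrec.fst (Primrec.fst.comp Primrec.snd)).and
      (hq'.comp Primrec.fst (Primrec.snd.comp Primrec.snd))
  refine (REPred.exists_of_primrecRel h).of_eq fun a => ?_
  simp [h1, h2]

protected theorem REPred.or {p q : α → Prop} (hp : REPred p) (hq : REPred q) :
    REPred fun a => p a ∨ q a := by
  obtain ⟨p', hp', h1, -⟩ := hp.exists_primrecRel
  obtain ⟨q', hq', h2, -⟩ := hq.exists_primrecRel
  refine (REPred.exists_of_primrecRel (q := fun a k => p' a k ∨ q' a k)
    (PrimrecPred.or hp' hq')).of_eq fun a => ?_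
  simp [h1, h2, exists_or]

/-- Each of the finitely many entries is confirmed at some stage; by monotonicity the largest of
these confirms them all. -/
protected theorem REPred.forall_mem_list {p : α → β → Prop}
    (hp : REPred fun x : α × β => p x.1 x.2) {f : α → List β} (hf : Primrec f) :
    REPred fun a => ∀ b ∈ f a, p a b := by
  obtain ⟨q, hq, hpq, hmono⟩ := hp.exists_primrecRel
  have h : PrimrecRel fun (a : α) (k : ℕ) => ∀ b ∈ f a, q (a, b) k := by
    have h' : PrimrecRel fun (b : β) (x : α × ℕ) => q (x.1, b) x.2 :=
      hq.comp ((Primrec.fst.comp Primrec.snd).pair Primrec.fst) (Primrec.snd.comp Primrec.snd)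
    exact h'.forall_mem_list.comp (hf.comp Primrec.fst) Primrec.id
  refine (REPred.exists_of_primrecRel h).of_eq fun a => ?_
  constructor
  · rintro ⟨k, hk⟩ b hb
    exact (hpq (a, b)).2 ⟨k, hk b hb⟩
  · intro H
    generalize f a = l at H ⊢
    induction l with
    | nil => exact ⟨0, by simp⟩
    | cons b l ih =>
      obtain ⟨k, hk⟩ := ih fun b hb => H b (List.mem_cons_of_mem _ hb)
      obtain ⟨j, hj⟩ := (hpq (a, b)).1 (H b List.mem_cons_self)
      refine ⟨max j k, fun c hc => ?_⟩
      rcases List.mem_cons.1 hc with rfl | hc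
      · exact hmono _ _ _ (le_max_left _ _) hj
      · exact hmono _ _ _ (le_max_right _ _) (hk c hc)

end RecursivelyEnumerable

/-! ### Enumerating a normal closure in a free group. -/

section FreeGroup

open FreeGroup

variable {α : Type*}

theorem FreeGroup.primrec_reduce [Primcodable α] [DecidableEq α] :
    Primrec (FreeGroup.reduce : List (α × Bool) → List (α × Bool)) := by
  have hstep : Primrec₂ fun (_ : List (α × Bool)) (y : (α × Bool) × List (α × Bool)) =>
      List.casesOn (motive := fun _ => List (α × Bool)) y.2 [y.1] fun hd tl =>
        if y.1.1 = hd.1 ∧ y.1.2 = !hd.2 then tl else y.1 :: hd :: tl := by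
    have hcons : Primrec₂ fun (z : List (α × Bool) × (α × Bool) × List (α × Bool))
        (t : (α × Bool) × List (α × Bool)) =>
        if z.2.1.1 = t.1.1 ∧ z.2.1.2 = !t.1.2 then t.2 else z.2.1 :: t.1 :: t.2 := by
      have hx : Primrec fun y : (List (α × Bool) × (α × Bool) × List (α × Bool)) ×
          ((α × Bool) × List (α × Bool)) => y.1.2.1 :=
        Primrec.fst.comp (Primrec.snd.comp Primrec.fst)
      have hhd : Primrec fun y : (List (α × Bool) × (α × Bool) × List (α × Bool)) ×
          ((α × Bool) × List (α × Bool)) => y.2.1 := Primrec.fst.comp Primrec.snd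
      have htl : Primrec fun y : (List (α × Bool) × (α × Bool) × List (α × Bool)) ×
          ((α × Bool) × List (α × Bool)) => y.2.2 := Primrec.snd.comp Primrec.snd
      exact Primrec.ite
        (PrimrecPred.and (Primrec.eq.comp (Primrec.fst.comp hx) (Primrec.fst.comp hhd))
          (Primrec.eq.comp (Primrec.snd.comp hx) (Primrec.not.comp (Primrec.snd.comp hhd))))
        htl (Primrec.list_cons.comp hx (Primrec.list_cons.comp hhd htl))
    exact Primrec.list_casesOn (Primrec.snd.comp Primrec.snd)
      (Primrec.list_cons.comp (Primrec.fst.comp Primrec.snd)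
        (Primrec.const ([] : List (α × Bool)))) hcons
  refine (Primrec.list_foldr Primrec.id (Primrec.const []) hstep).of_eq fun L => ?_
  induction L with
  | nil => rfl
  | cons x L ih =>
    rw [FreeGroup.reduce.cons, ← ih]
    rfl

theorem FreeGroup.primrec_invRev [Primcodable α] :
    Primrec (FreeGroup.invRev : List (α × Bool) → List (α × Bool)) :=
  Primrec.list_reverse.comp (Primrec.list_map Primrec.id
    ((Primrec.fst.comp Primrec.snd).pair (Primrec.not.comp (Primrec.snd.comp Primrec.snd))))

/-- The product of the conjugates of the words `x.2.1` or their inverses by the words `x.1`. -/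
def FreeGroup.conjWord (c : List (List (α × Bool) × List (α × Bool) × Bool)) : List (α × Bool) :=
  c.flatMap fun x => x.1 ++ (bif x.2.2 then x.2.1 else invRev x.2.1) ++ invRev x.1

theorem FreeGroup.primrec_conjWord [Primcodable α] :
    Primrec (FreeGroup.conjWord : List (List (α × Bool) × List (α × Bool) × Bool) → _) := by
  refine Primrec.list_flatMap Primrec.id ?_
  have h1 : Primrec fun y : List (List (α × Bool) × List (α × Bool) × Bool) ×
      (List (α × Bool) × List (α × Bool) × Bool) => y.2.1 := Primrec.fst.comp Primrec.snd
  have h2 : Primrec fun y : List (List (α × Bool) × List (α × Bool) × Bool) ×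
      (List (α × Bool) × List (α × Bool) × Bool) => y.2.2.1 :=
    Primrec.fst.comp (Primrec.snd.comp Primrec.snd)
  exact Primrec.list_append.comp (Primrec.list_append.comp h1
    (Primrec.cond (Primrec.snd.comp (Primrec.snd.comp Primrec.snd)) h2 (primrec_invRev.comp h2)))
    (primrec_invRev.comp h1)

/-- The list `c` is a finite certificate. Comparing reduced words makes equality in the free group
primitive recursive. -/
theorem FreeGroup.mk_mem_normalClosure_iff [DecidableEq α] {V : Set (List (α × Bool))}
    {w : List (α × Bool)} :
    FreeGroup.mk w ∈ Subgroup.normalClosure (FreeGroup.mk '' V) ↔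
      ∃ c : List (List (α × Bool) × List (α × Bool) × Bool),
        (∀ x ∈ c, x.2.1 ∈ V) ∧ reduce w = reduce (conjWord c) := by
  constructor
  · intro h
    rw [Subgroup.normalClosure, ← Subgroup.mem_toSubmonoid, Subgroup.closure_toSubmonoid] at h
    obtain ⟨l, hl, hw⟩ := Submonoid.exists_list_of_mem_closure h
    suffices H : ∃ c : List (List (α × Bool) × List (α × Bool) × Bool),
        (∀ x ∈ c, x.2.1 ∈ V) ∧ l.prod = mk (conjWord c) by
      obtain ⟨c, hc, hlc⟩ := H
      exact ⟨c, hc, reduce.sound (hw.symm.trans hlc)⟩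
    clear hw h
    induction l with
    | nil => exact ⟨[], by simp, rfl⟩
    | cons y l ih =>
      obtain ⟨c, hc, hlc⟩ := ih fun z hz => hl z (List.mem_cons_of_mem _ hz)
      have key : ∃ x : List (α × Bool) × List (α × Bool) × Bool, x.2.1 ∈ V ∧
          y = mk (x.1 ++ (bif x.2.2 then x.2.1 else invRev x.2.1) ++ invRev x.1) := by
        rcases hl y List.mem_cons_self with hy | hy
        · obtain ⟨_, ⟨r, hr, rfl⟩, hconj⟩ := Group.mem_conjugatesOfSet_iff.1 hy
          obtain ⟨g, hg⟩ := isConj_iff.1 hconj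
          refine ⟨(g.toWord, r, true), hr, ?_⟩
          simp only [cond_true, ← mul_mk, ← inv_mk, mk_toWord]
          exact hg.symm
        · obtain ⟨_, ⟨r, hr, rfl⟩, hconj⟩ := Group.mem_conjugatesOfSet_iff.1 hy
          obtain ⟨g, hg⟩ := isConj_iff.1 hconj
          refine ⟨(g.toWord, r, false), hr, ?_⟩
          simp only [cond_false, ← mul_mk, ← inv_mk, mk_toWord]
          rw [← inv_inv y, ← hg]
          group
      obtain ⟨x, hx, rfl⟩ := key
      refine ⟨x :: c, ?_, ?_⟩
      · intro z hz
        rcases List.mem_cons.1 hz with rfl | hz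
        exacts [hx, hc z hz]
      · rw [List.prod_cons, hlc, mul_mk]
        rfl
  · rintro ⟨c, hc, h⟩
    rw [reduce.exact h]
    clear h
    induction c with
    | nil => exact one_mem _
    | cons x c ih =>
      have : mk (conjWord (x :: c)) =
          mk x.1 * mk (bif x.2.2 then x.2.1 else invRev x.2.1) * (mk x.1)⁻¹ * mk (conjWord c) := by
        simp only [mul_mk, inv_mk]
        rfl
      rw [this]
      refine mul_mem (Subgroup.normalClosure_normal.conj_mem _ ?_ _)
        (ih fun z hz => hc z (List.mem_cons_of_mem _ hz))
      have hx : mk x.2.1 ∈ Subgroup.normalClosure (mk '' V) :=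
        Subgroup.subset_normalClosure ⟨_, hc x List.mem_cons_self, rfl⟩
      cases x.2.2
      · simpa only [cond_false, ← inv_mk] using inv_mem hx
      · exact hx

theorem REPred.mk_mem_normalClosure [Primcodable α] {V : Set (List (α × Bool))}
    (hV : REPred fun w => w ∈ V) :
    REPred fun w => FreeGroup.mk w ∈ Subgroup.normalClosure (FreeGroup.mk '' V) := by
  classical
  simp only [FreeGroup.mk_mem_normalClosure_iff]
  refine REPred.exists (REPred.and ?_ ?_)
  · exact REPred.forall_mem_list
      (hV.comp (Primrec.fst.comp (Primrec.snd.comp Primrec.snd)).to_comp) Primrec.snd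
  · exact (Primrec.eq.comp (primrec_reduce.comp Primrec.fst)
      (primrec_reduce.comp (primrec_conjWord.comp Primrec.snd))).to_re

end FreeGroup

/-! ### Semidecidability of word equality and of subgroup membership. -/

namespace SubgroupRealizability

variable {G : Type*} [Group G]

theorem wordEval_append {n : ℕ} (s : Fin n → G) (u v : List (Fin n)) :
    wordEval s (u ++ v) = wordEval s u * wordEval s v := by
  simp [wordEval]

theorem wordEval_surjective {n : ℕ} {s : Fin n → G} (hs : IsSymmGenerating s) :
    Function.Surjective (wordEval s) := by
  intro g
  have hg : g ∈ Subgroup.closure (Set.range s) := hs.2 ▸ Subgroup.mem_top g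
  rw [← Subgroup.mem_toSubmonoid, Subgroup.closure_toSubmonoid, hs.1, Set.union_self] at hg
  obtain ⟨l, hl, rfl⟩ := Submonoid.exists_list_of_mem_closure hg
  obtain ⟨w, rfl⟩ : l ∈ Set.range (List.map s) := by rwa [Set.range_list_map]
  exact ⟨w, rfl⟩

/-- In a recursively presented group, equality of the elements represented by two words over a
finite tuple is recursively enumerable. -/
theorem IsRecursivelyPresented.re_wordEval_eq (hG : IsRecursivelyPresented G) {n : ℕ}
    (s : Fin n → G) :
    REPred fun p : List (Fin n) × List (Fin n) => wordEval s p.1 = wordEval s p.2 := by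
  classical
  obtain ⟨S, R, -, hR, ⟨e⟩⟩ := hG
  set emb : S × Bool → ℕ × Bool := fun a => ((a.1 : ℕ), a.2) with hemb
  set V : Set (List (ℕ × Bool)) :=
    {w | ∃ v : List (S × Bool), v.map emb = w ∧ FreeGroup.mk v ∈ R} with hV
  have hex : ∀ i, ∃ v : List (S × Bool), PresentedGroup.mk R (FreeGroup.mk v) = e (s i) := by
    intro i
    obtain ⟨x, hx⟩ := PresentedGroup.mk_surjective R (e (s i))
    exact ⟨x.toWord, by rw [FreeGroup.mk_toWord, hx]⟩
  choose t ht using hex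
  set τ : List (Fin n) → List (S × Bool) := fun w => w.flatMap t with hτ
  have hτe : ∀ w, PresentedGroup.mk R (FreeGroup.mk (τ w)) = e (wordEval s w) := by
    intro w
    induction w with
    | nil => simp [hτ, wordEval, ← FreeGroup.one_eq_mk]
    | cons i w ih =>
      have h1 : FreeGroup.mk (τ (i :: w)) = FreeGroup.mk (t i) * FreeGroup.mk (τ w) := by
        simp [hτ, FreeGroup.mul_mk]
      rw [h1, map_mul, ih, ht, ← map_mul]
      rfl
  -- Passing from `S` to all of `ℕ` lets words be coded directly; the extra free letters create no
  -- new relations among words over `S`.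
  have hincl : ∀ v : List (S × Bool), FreeGroup.mk v ∈ Subgroup.normalClosure R ↔
      FreeGroup.mk (v.map emb) ∈ Subgroup.normalClosure (FreeGroup.mk '' V) := by
    intro v
    have hmap : ∀ v : List (S × Bool), FreeGroup.map (Subtype.val : S → ℕ) (FreeGroup.mk v) =
      FreeGroup.mk (v.map emb) := fun v => FreeGroup.map.mk
    constructor
    · intro h
      have hle : Subgroup.normalClosure R ≤
          (Subgroup.normalClosure (FreeGroup.mk '' V)).comap
            (FreeGroup.map (Subtype.val : S → ℕ)) := by
        refine Subgroup.normalClosure_le_normal fun r hr => Subgroup.subset_normalClosure ?_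
        refine ⟨r.toWord.map emb, ⟨r.toWord, rfl, by rwa [FreeGroup.mk_toWord]⟩, ?_⟩
        rw [← hmap, FreeGroup.mk_toWord]
      rw [← hmap]
      exact hle h
    · intro h
      -- A retraction onto `FreeGroup S` that kills the letters outside `S` and carries the relators
      -- back into `R`.
      set ρ : FreeGroup ℕ →* FreeGroup S :=
        FreeGroup.lift fun k => if hk : k ∈ S then FreeGroup.of ⟨k, hk⟩ else 1 with hρ
      have hρmap : ∀ x : FreeGroup S, ρ (FreeGroup.map Subtype.val x) = x := by
        intro x
        have : ρ.comp (FreeGroup.map (Subtype.val : S → ℕ)) = MonoidHom.id _ := by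
          ext k
          simp [hρ]
        exact DFunLike.congr_fun this x
      have hle : Subgroup.normalClosure (FreeGroup.mk '' V) ≤
          (Subgroup.normalClosure R).comap ρ := by
        refine Subgroup.normalClosure_le_normal ?_
        rintro _ ⟨_, ⟨v, rfl, hv⟩, rfl⟩
        refine Subgroup.subset_normalClosure ?_
        rwa [← hmap, hρmap]
      have := hle h
      rwa [Subgroup.mem_comap, ← hmap, hρmap] at this
  have hre := REPred.mk_mem_normalClosure (V := V) hR
  have htrans : Primrec fun w : List (Fin n) => (τ w).map emb := by
    refine (Primrec.list_flatMap (g := fun _ i => (t i).map emb) Primrec.id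
      ((Primrec.dom_finite fun i => (t i).map emb).comp Primrec.snd)).of_eq fun w => ?_
    simp [hτ, List.map_flatMap]
  refine (hre.comp (f := fun p : List (Fin n) × List (Fin n) =>
    (τ p.1).map emb ++ FreeGroup.invRev ((τ p.2).map emb)) ?_).of_eq fun p => ?_
  · exact (Primrec.list_append.comp (htrans.comp Primrec.fst)
      (FreeGroup.primrec_invRev.comp (htrans.comp Primrec.snd))).to_comp
  · have h1 : (τ p.1).map emb ++ FreeGroup.invRev ((τ p.2).map emb) =
        (τ p.1 ++ FreeGroup.invRev (τ p.2)).map emb := by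
      simp [FreeGroup.invRev, hemb, Function.comp_def]
    rw [h1, ← hincl, ← PresentedGroup.mk_eq_one_iff, ← FreeGroup.mul_mk, ← FreeGroup.inv_mk,
      map_mul, map_inv, mul_inv_eq_one, hτe, hτe, e.injective.eq_iff]

/-- Membership in a finitely generated subgroup of a recursively presented group is recursively
enumerable. -/
theorem IsRecursivelyPresented.re_wordEval_mem (hG : IsRecursivelyPresented G) {n : ℕ}
    {s : Fin n → G} (hs : IsSymmGenerating s) {H : Subgroup G} (hH : H.FG) :
    REPred fun u : List (Fin n) => wordEval s u ∈ H := by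
  classical
  obtain ⟨B, rfl⟩ := hH
  have hfin : ((B : Set G) ∪ (B : Set G)⁻¹).Finite := B.finite_toSet.union B.finite_toSet.inv
  choose word hword using wordEval_surjective hs
  set gens : List (List (Fin n)) := hfin.toFinset.toList.map word with hgens
  have hre : REPred fun u : List (Fin n) => ∃ l : List (List (Fin n)),
      (∀ w ∈ l, w ∈ gens) ∧ wordEval s u = wordEval s l.flatten := by
    refine REPred.exists (REPred.and ?_ ?_)
    · exact REPred.forall_mem_list (p := fun _ w => w ∈ gens)
        ((PrimrecPred.mem_list gens).comp Primrec.snd).to_re Primrec.snd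
    · exact (hG.re_wordEval_eq s).comp
        (Primrec.fst.pair (Primrec.list_flatten.comp Primrec.snd)).to_comp
  refine hre.of_eq fun u => ?_
  have hflat : ∀ l : List (List (Fin n)), wordEval s l.flatten = (l.map (wordEval s)).prod := by
    intro l
    induction l with
    | nil => rfl
    | cons w l ih => rw [List.flatten_cons, wordEval_append, ih]; rfl
  have hmem : ∀ w ∈ gens, wordEval s w ∈ (B : Set G) ∪ (B : Set G)⁻¹ := by
    intro w hw
    obtain ⟨g, hg, rfl⟩ := List.mem_map.1 hw
    rw [hword]
    simpa using hg
  constructor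
  · rintro ⟨l, hl, h⟩
    rw [h, hflat]
    refine Subgroup.list_prod_mem _ fun g hg => ?_
    obtain ⟨w, hw, rfl⟩ := List.mem_map.1 hg
    rcases hmem w (hl w hw) with h | h
    · exact Subgroup.subset_closure h
    · exact inv_mem_iff.1 (Subgroup.subset_closure h)
  · intro h
    rw [← Subgroup.mem_toSubmonoid, Subgroup.closure_toSubmonoid] at h
    obtain ⟨l, hl, hprod⟩ := Submonoid.exists_list_of_mem_closure h
    refine ⟨l.map word, fun w hw => ?_, ?_⟩
    · obtain ⟨g, hg, rfl⟩ := List.mem_map.1 hw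
      exact List.mem_map_of_mem (by simpa using hl g hg)
    · rw [hflat, ← hprod]
      simp [Function.comp_def, hword]

end SubgroupRealizability

/-! ### Compactness of the space of sequences over a finite alphabet. -/

section Compactness

variable {A : Type*} [Fintype A]

/-- All lists of length `N` over a finite type. -/
noncomputable def List.allOfLength (A : Type*) [Fintype A] : ℕ → List (List A) :=
  Nat.rec [[]] fun _ L => L.flatMap fun l => (Finset.univ : Finset A).toList.map (· :: l)

theorem List.mem_allOfLength {N : ℕ} {l : List A} : l ∈ allOfLength A N ↔ l.length = N := by
  induction N generalizing l with
  | zero => simp [allOfLength]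
  | succ N ih =>
    have h : l ∈ allOfLength A (N + 1) ↔ ∃ t ∈ allOfLength A N, ∃ a : A, a :: t = l := by
      simp [allOfLength]
    rw [h]
    cases l with
    | nil => simp
    | cons a t => simp [ih]

theorem List.primrec_allOfLength [Primcodable A] : Primrec (allOfLength A) := by
  refine Primrec.nat_rec₁ (f := fun _ L => L.flatMap fun l =>
    (Finset.univ : Finset A).toList.map (· :: l)) [[]] ?_
  exact Primrec.list_flatMap Primrec.snd (Primrec.list_map (Primrec.const _)
    (Primrec.list_cons.comp Primrec.snd (Primrec.snd.comp Primrec.fst)))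

/-- By compactness, if every sequence over a finite type extends one of the given finite partial
sequences, then so does every sequence of some fixed finite length. -/
theorem exists_length_forall_list_extends [Inhabited A] (C : Set (List (ℕ × A))) :
    (∀ y : ℕ → A, ∃ c ∈ C, ∀ p ∈ c, y p.1 = p.2) ↔
      ∃ N : ℕ, ∀ l : List A, l.length = N → ∃ c ∈ C, ∀ p ∈ c, l[p.1]? = some p.2 := by
  constructor
  · intro h
    let _ : TopologicalSpace A := ⊥
    have : DiscreteTopology A := ⟨rfl⟩
    have hopen : ∀ c : C, IsOpen {y : ℕ → A | ∀ p ∈ c.1, y p.1 = p.2} := by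
      intro c
      have : {y : ℕ → A | ∀ p ∈ c.1, y p.1 = p.2} =
          ⋂ p ∈ {p | p ∈ c.1}, {y : ℕ → A | y p.1 = p.2} := by
        ext y
        simp
      rw [this]
      exact (List.finite_toSet c.1).isOpen_biInter fun p _ =>
        (isOpen_discrete {p.2}).preimage (continuous_apply (A := fun _ : ℕ => A) p.1)
    obtain ⟨t, ht⟩ := isCompact_univ.elim_finite_subcover _ hopen fun y _ => by
      obtain ⟨c, hc, hy⟩ := h y
      exact Set.mem_iUnion.2 ⟨⟨c, hc⟩, hy⟩
    obtain ⟨N, hN⟩ : ∃ N : ℕ, ∀ c ∈ t, ∀ p ∈ c.1, p.1 < N := by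
      have hfin : (⋃ c ∈ t, Prod.fst '' {p | p ∈ c.1}).Finite :=
        t.finite_toSet.biUnion fun c _ => (List.finite_toSet c.1).image _
      obtain ⟨N, hN⟩ := hfin.bddAbove
      refine ⟨N + 1, fun c hc p hp => Nat.lt_succ_of_le (hN ?_)⟩
      exact Set.mem_biUnion hc ⟨p, hp, rfl⟩
    refine ⟨N, fun l hl => ?_⟩
    -- Padding with `default` is harmless: the chosen `c` only reads positions below `N`.
    obtain ⟨c, hc, hy⟩ := Set.mem_iUnion₂.1 (ht (Set.mem_univ fun k => l.getD k default))
    refine ⟨c.1, c.2, fun p hp => ?_⟩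
    have hlt : p.1 < l.length := hl ▸ hN c hc p hp
    have hyp : l.getD p.1 default = p.2 := hy p hp
    rw [← hyp, List.getElem?_eq_getElem hlt, List.getD_eq_getElem _ _ hlt]
  · rintro ⟨N, hN⟩ y
    obtain ⟨c, hc, hl⟩ := hN ((List.range N).map y) (by simp)
    refine ⟨c, hc, fun p hp => ?_⟩
    obtain ⟨hlt, hy⟩ := List.getElem?_eq_some_iff.1 (hl p hp)
    simpa using hy

/-- It is semidecidable whether every sequence over a finite type extends a member of a recursively
enumerable family of finite partial sequences. -/
theorem REPred.forall_exists_extends [Primcodable A] [Inhabited A] {α : Type*} [Primcodable α]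
    {C : α → List (ℕ × A) → Prop} (hC : REPred fun x : α × List (ℕ × A) => C x.1 x.2) :
    REPred fun a => ∀ y : ℕ → A, ∃ c, C a c ∧ ∀ p ∈ c, y p.1 = p.2 := by
  classical
  have hext : PrimrecRel fun (c : List (ℕ × A)) (l : List A) => ∀ p ∈ c, l[p.1]? = some p.2 :=
    PrimrecRel.forall_mem_list (R := fun (p : ℕ × A) (l : List A) => l[p.1]? = some p.2)
      (Primrec.eq.comp (Primrec.list_getElem?.comp Primrec.snd (Primrec.fst.comp Primrec.fst))
        (Primrec.option_some.comp (Primrec.snd.comp Primrec.fst)))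
  have hlist : REPred fun x : (α × ℕ) × List A =>
      ∃ c, C x.1.1 c ∧ ∀ p ∈ c, x.2[p.1]? = some p.2 := by
    have hf : Primrec fun z : ((α × ℕ) × List A) × List (ℕ × A) => (z.1.1.1, z.2) :=
      (Primrec.fst.comp (Primrec.fst.comp Primrec.fst)).pair Primrec.snd
    have h1 := hC.comp hf.to_comp
    have h2 : REPred fun z : ((α × ℕ) × List A) × List (ℕ × A) =>
        ∀ p ∈ z.2, z.1.2[p.1]? = some p.2 :=
      PrimrecPred.to_re (hext.comp Primrec.snd (Primrec.snd.comp Primrec.fst))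
    exact REPred.exists (h1.and h2)
  have hall : REPred fun x : α × ℕ => ∀ l ∈ List.allOfLength A x.2,
      ∃ c, C x.1 c ∧ ∀ p ∈ c, l[p.1]? = some p.2 :=
    REPred.forall_mem_list hlist (List.primrec_allOfLength.comp Primrec.snd)
  have hre : REPred fun a : α => ∃ N : ℕ, ∀ l ∈ List.allOfLength A N,
      ∃ c, C a c ∧ ∀ p ∈ c, l[p.1]? = some p.2 := REPred.exists hall
  refine hre.of_eq fun a => ?_
  simp only [List.mem_allOfLength]
  exact (exists_length_forall_list_extends {c | C a c}).symm

end Compactness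

/-! ### Finite obstructions to being a fixed point of a subshift. -/

namespace SubgroupRealizability

open SymbolicDynamics.FullShift Encodable

variable {G : Type*} [Group G]

theorem mem_stab_iff_mul {A : Type*} {x : G → A} {g : G} :
    g ∈ stab x ↔ ∀ h : G, x (g * h) = x h := by
  rw [mem_stab_iff]
  constructor
  · intro H h
    rw [← H (g * h), inv_mul_cancel_left]
  · intro H h
    rw [← H (g⁻¹ * h), mul_inv_cancel_left]

/-- In a recursively presented group, it is semidecidable whether an element fixes no configuration
of a given subshift of finite type. -/
theorem IsSFT.re_forall_wordEval_notMem_stab {A : Type*} [Finite A] [Inhabited A]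
    (hG : IsRecursivelyPresented G) {n : ℕ} {s : Fin n → G} (hs : IsSymmGenerating s)
    {X : Set (G → A)} (hX : IsSFT X) :
    REPred fun u : List (Fin n) => ∀ x ∈ X, wordEval s u ∉ stab x := by
  classical
  let _ : Fintype A := Fintype.ofFinite A
  let _ : Primcodable A := Primcodable.ofEquiv (Fin (Fintype.card A)) (Fintype.equivFin A)
  obtain ⟨F, hF, rfl⟩ := hX
  choose word hword using wordEval_surjective hs
  set pats : List (List (List (Fin n) × A)) :=
    hF.toFinset.toList.map fun p => p.support.toList.map fun h => (word h, p.config h) with hpats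
  -- Obstructions of two kinds: different letters at two words that represent the same element or
  -- differ by the prefix `u`; or a forbidden pattern, translated by the word `q.2`.
  let C : List (Fin n) → List (ℕ × A) → Prop := fun u c =>
    (∃ q : (List (Fin n) × List (Fin n)) × A × A,
      ((wordEval s q.1.1 = wordEval s q.1.2 ∨ q.1.1 = u ++ q.1.2) ∧ q.2.1 ≠ q.2.2) ∧
        c = [(encode q.1.1, q.2.1), (encode q.1.2, q.2.2)]) ∨
    ∃ q : List (List (Fin n) × A) × List (Fin n),
      q.1 ∈ pats ∧ c = q.1.map fun r => (encode (q.2 ++ r.1), r.2)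
  have hC : REPred fun x : List (Fin n) × List (ℕ × A) => C x.1 x.2 := by
    refine REPred.or (REPred.exists (REPred.and (REPred.and (REPred.or ?_ ?_) ?_) ?_))
      (REPred.exists (REPred.and ?_ ?_))
    · exact (hG.re_wordEval_eq s).comp (Primrec.fst.comp Primrec.snd).to_comp
    · exact (Primrec.eq.comp (Primrec.fst.comp (Primrec.fst.comp Primrec.snd))
        (Primrec.list_append.comp (Primrec.fst.comp Primrec.fst)
          (Primrec.snd.comp (Primrec.fst.comp Primrec.snd)))).to_re
    · exact (Primrec.eq.comp (Primrec.fst.comp (Primrec.snd.comp Primrec.snd))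
        (Primrec.snd.comp (Primrec.snd.comp Primrec.snd))).not.to_re
    · refine (Primrec.eq.comp (Primrec.snd.comp Primrec.fst) (Primrec.list_cons.comp ?_
        (Primrec.list_cons.comp ?_ (Primrec.const [])))).to_re
      · exact (Primrec.encode.comp (Primrec.fst.comp (Primrec.fst.comp Primrec.snd))).pair
          (Primrec.fst.comp (Primrec.snd.comp Primrec.snd))
      · exact (Primrec.encode.comp (Primrec.snd.comp (Primrec.fst.comp Primrec.snd))).pair
          (Primrec.snd.comp (Primrec.snd.comp Primrec.snd))
    · exact ((PrimrecPred.mem_list pats).comp (Primrec.fst.comp Primrec.snd)).to_re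
    · refine (Primrec.eq.comp (Primrec.snd.comp Primrec.fst)
        (Primrec.list_map (Primrec.fst.comp Primrec.snd) ?_)).to_re
      exact (Primrec.encode.comp (Primrec.list_append.comp
        (Primrec.snd.comp (Primrec.snd.comp Primrec.fst)) (Primrec.fst.comp Primrec.snd))).pair
          (Primrec.snd.comp Primrec.snd)
  refine (REPred.forall_exists_extends hC).of_eq fun u => ?_
  constructor
  · intro h x hx hu
    rw [mem_stab_iff_mul] at hu
    -- Pull `x` back along `wordEval`. The value at numbers that code no word is irrelevant, as
    -- obstructions mention only codes of words.
    obtain ⟨c, hc, hy⟩ := h fun k => ((decode (α := List (Fin n)) k).map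
      fun w => x (wordEval s w)).getD default
    rcases hc with ⟨⟨⟨w, w'⟩, a, b⟩, ⟨hww, hab⟩, rfl⟩ | ⟨⟨f, g⟩, hf, rfl⟩
    · simp only [List.mem_cons, List.not_mem_nil, or_false, forall_eq_or_imp, forall_eq, encodek,
        Option.map_some, Option.getD_some] at hy
      refine hab ?_
      rw [← hy.1, ← hy.2]
      rcases hww with hww | hww
      · exact congrArg x hww
      · dsimp only at hww
        rw [hww, wordEval_append, hu]
    · obtain ⟨p, hp, rfl⟩ := List.mem_map.1 hf
      refine hx p (by simpa using hp) (wordEval s g) fun k hk => ?_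
      have := hy (encode (g ++ word k), p.config k)
        (List.mem_map.2 ⟨(word k, p.config k), List.mem_map.2 ⟨k, by simpa using hk, rfl⟩, rfl⟩)
      simpa [wordEval_append, hword] using this
  · intro h y
    by_contra! hy
    have hcongr : ∀ w w', (wordEval s w = wordEval s w' ∨ w = u ++ w') →
        y (encode w) = y (encode w') := by
      intro w w' hww
      by_contra hne
      obtain ⟨p, hp, hpne⟩ := hy _ (Or.inl ⟨((w, w'), y (encode w), y (encode w')), ⟨hww, hne⟩, rfl⟩)
      simp only [List.mem_cons, List.not_mem_nil, or_false] at hp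
      rcases hp with rfl | rfl <;> exact hpne rfl
    -- An obstruction-free `y` descends to `G`: by `hcongr` the chosen representative `word g` does
    -- not matter.
    refine h (fun g => y (encode (word g))) (fun p hp g hpg => ?_) (mem_stab_iff_mul.2 fun g => ?_)
    · obtain ⟨r, hr, hrne⟩ := hy _ (Or.inr ⟨(_, word g),
        List.mem_map.2 ⟨p, by simpa using hp, rfl⟩, rfl⟩)
      simp only [List.map_map, List.mem_map, Finset.mem_toList, Function.comp_apply] at hr
      obtain ⟨k, hk, rfl⟩ := hr
      refine hrne ?_
      rw [← hpg k hk]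
      exact hcongr _ _ (Or.inl (by rw [wordEval_append, hword, hword, hword]))
    · rw [hcongr (word (wordEval s u * g)) (u ++ word g)
        (Or.inl (by rw [wordEval_append, hword, hword]))]
      exact hcongr _ _ (Or.inr rfl)

end SubgroupRealizability

/-! ### Conclusion by Post's theorem. -/

theorem theoremB {G : Type*} [Group G] [Group.FG G]
    (hG : SubgroupRealizability.IsRecursivelyPresented G)
    (H : Subgroup G) (hfg : H.FG) (hH : SubgroupRealizability.IsRealizable H) :
    ∀ (n : ℕ) (s : Fin n → G), SubgroupRealizability.IsSymmGenerating s →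
      SubgroupRealizability.MembershipDecidable s H := by
  intro n s hs
  obtain ⟨A, hA, hA', X, hX, ⟨x₀, hx₀⟩, himg⟩ := hH
  have hstab : ∀ x ∈ X, SubgroupRealizability.stab x = H := fun x hx =>
    himg.subset ⟨x, hx, rfl⟩
  have hco : REPred fun u : List (Fin n) => ¬ SubgroupRealizability.wordEval s u ∈ H := by
    refine (hX.re_forall_wordEval_notMem_stab hG hs).of_eq fun u => ?_
    constructor
    -- Non-emptiness of `X` enters here: over an empty `X` the semidecided condition would be
    -- vacuous.
    · intro h
      rw [← hstab x₀ hx₀]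
      exact h x₀ hx₀
    · intro h x hx
      rwa [hstab x hx]
  obtain ⟨hdec, hcomp⟩ := ComputablePred.computable_iff_re_compl_re'.2
    ⟨hG.re_wordEval_mem hs hfg, hco⟩
  exact ⟨fun p => decide (SubgroupRealizability.wordEval s p.1 ∈ H), hcomp.comp Computable.fst,
    fun u ws _ => decide_eq_true_iff⟩
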